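/- **Definitions.** Let $(\mathbb{P},\le)$ be a poset. A *band* is a finite $B\subseteq\mathbb{P}$ such that every $p\in\mathbb{P}$ is comparable to some $b\in B$. A *cap* is a subset $C\subseteq\mathbb{P}$ such that, for some band $B$, every $b\in B$ lies below some $c\in C$; $\mathsf{C}\mathbb{P}$ denotes the set of caps. Write $p\wedge q$ if $p$ and $q$ have a common lower bound and $Cp=\{c\in C: c\wedge p\}$. Write $q\vartriangleright p$ (or $p\vartriangleleft q$) if there is a cap $C$ with $c\le q$ for all $c\in Cp$. A *selector* is a subset of $\mathbb{P}$ meeting every cap. The *spectrum* $\mathsf{S}\mathbb{P}$ is the set of (inclusion-)minimal selectors with the topology generated by the sets $p^\in=\{S\in\mathsf{S}\mathbb{P}:p\in S\}$, $p\in\mathbb{P}$. The poset $\mathbb{P}$ is * an *$\omega$-poset* if every principal filter $\{q:q\ge p\}$ is finite and, for each $n$, only finitely many principal filters have exactly $n$ elements; * *regular* if for every cap $C$ there is a cap $D$ such that every $d\in D$ satisfies $d\vartriangleleft c$ for some $c\in C$; * *prime* if every $p\in\mathbb{P}$ lies in some minimal selector. A relation ${\sqsupset}\subseteq\mathbb{Q}\times\mathbb{P}$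 between posets is a *refiner* if for every cap $C$ of $\mathbb{Q}$ there is a cap $D$ of $\mathbb{P}$ such that every $d\in D$ satisfies $c\sqsupset d$ for some $c\in C$. It is *$\wedge$-preserving* if $q\sqsupset p$, $p\wedge p'$ and $q'\sqsupset p'$ imply $q\wedge q'$. Its *star* is given by $q\sqsupset^*p$ if and only if there is $C\in\mathsf{C}\mathbb{P}$ with $q\sqsupset c$ for all $c\in Cp$. The *star-composition* of ${\sqsupset'}\subseteq\mathbb{R}\times\mathbb{Q}$ and ${\sqsupset}\subseteq\mathbb{Q}\times\mathbb{P}$ is ${\sqsupset'*\sqsupset}=(\sqsupset'\circ\sqsupset)^*$, where $\circ$ is the usual composition of relations. A *strong refiner* is a $\wedge$-preserving refiner ${\sqsupset}\subseteq\mathbb{Q}\times\mathbb{P}$ with ${\sqsupset}={\vartriangleright_{\mathbb{Q}}*\sqsupset}$. Let $\mathbf{K}$ be the category of metrisable compact spaces and continuous maps. Let $\mathbf{P}$ be the category whose objects are the regular prime $\omega$-posets and whose morphisms $\mathbb{P}\to\mathbb{Q}$ are the $\wedge$-preserving refiners ${\sqsupset}\subseteq\mathbb{Q}\times\mathbb{P}$,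 with composition $\circ$ and identities the equality relations. Let $\mathbf{S}$ be the category with the same objects, whose morphisms $\mathbb{P}\to\mathbb{Q}$ are the strong refiners ${\sqsupset}\subseteq\mathbb{Q}\times\mathbb{P}$, with composition $*$ and identities $\vartriangleright_{\mathbb{P}}$. Let $\mathsf{S}$ be the map sending a regular prime $\omega$-poset $\mathbb{P}$ to its spectrum $\mathsf{S}\mathbb{P}$ and a $\wedge$-preserving refiner ${\sqsupset}\subseteq\mathbb{Q}\times\mathbb{P}$ to the continuous map $\phi_\sqsupset:\mathsf{S}\mathbb{P}\to\mathsf{S}\mathbb{Q}$, $$\phi_\sqsupset(S)=\{q\in\mathbb{Q}:\ \exists\,s\in S\ \exists\,q'\in\mathbb{Q}\ \ (q\vartriangleright q'\sqsupset s)\}.$$ **Theorem.** $\mathsf{S}$ is a functor from $\mathbf{P}$ to $\mathbf{K}$. Its restriction $\mathsf{S}|_{\mathbf{S}}:\mathbf{S}\to\mathbf{K}$ to strong refiners is a functor which is full, faithful and essentially surjective; in other words, it is an equivalence of categories. Moreover, the map $\mathsf{Q}$ that is the identity on objects and is given by $\mathsf{Q}(\sqsupset)={\vartriangleright*\sqsupset}$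 on morphisms is a functor from $\mathbf{P}$ to $\mathbf{S}$, and $\mathsf{S}=\mathsf{S}|_{\mathbf{S}}\circ\mathsf{Q}$. -/

import Mathlib

open CategoryTheory

universe u

namespace OmegaPoset

section Order

variable {P : Type*} [PartialOrder P]

/-- A band is a finite subset such that every element of the poset is comparable to some
element of it. -/
def IsBand (B : Set P) : Prop :=
  B.Finite ∧ ∀ p, ∃ b ∈ B, p ≤ b ∨ b ≤ p

/-- A cap is a subset refined by some band. -/
def IsCap (C : Set P) : Prop :=
  ∃ B, IsBand B ∧ ∀ b ∈ B, ∃ c ∈ C, b ≤ c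

/-- The common lower bound relation `p ∧ q`. -/
def Compat (p q : P) : Prop :=
  ∃ r, r ≤ p ∧ r ≤ q

/-- `C p = {c ∈ C | c ∧ p}`, the star of `p` in `C`. -/
def starOf (C : Set P) (p : P) : Set P :=
  {c | c ∈ C ∧ Compat c p}

/-- The star-above relation: `StarAbove q p` is `q ▷ p` (equivalently `p ◁ q`), meaning that all
elements of the star of `p` in some cap lie below `q`. -/
def StarAbove (q p : P) : Prop :=
  ∃ C : Set P, IsCap C ∧ ∀ c ∈ starOf C p, c ≤ q

/-- A selector overlaps every cap. -/
def IsSelector (S : Set P) : Prop :=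
  ∀ C : Set P, IsCap C → (S ∩ C).Nonempty

/-- The up-closure `S^◁` of `S` with respect to the star-below relation. -/
def starUp (S : Set P) : Set P :=
  {q | ∃ p ∈ S, StarAbove q p}

variable (P)

/-- An ω-poset: every principal filter is finite and, for each `n`, there are only finitely many
principal filters with `n` elements (in a poset a principal filter has a unique generator, so we
count generators). -/
def IsOmega : Prop :=
  (∀ p : P, (Set.Ici p).Finite) ∧ ∀ n : ℕ, {p : P | (Set.Ici p).ncard = n}.Finite

/-- A poset is regular if every cap is `◁`-refined by a cap. -/
def IsRegular : Prop :=
  ∀ C : Set P, IsCap C → ∃ D : Set P, IsCap D ∧ ∀ d ∈ D, ∃ c ∈ C, StarAbove c d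

/-- A poset is prime if every element lies in some minimal selector. -/
def IsPrime : Prop :=
  ∀ p : P, ∃ S : Set P, Minimal IsSelector S ∧ p ∈ S

/-- The spectrum of a poset: the set of minimal selectors. -/
@[ext]
structure Spectrum where
  carrier : Set P
  minimal : Minimal IsSelector carrier

/-- The topology of the spectrum is generated by the sets `p^∈ = {S | p ∈ S}`. -/
instance : TopologicalSpace (Spectrum P) :=
  TopologicalSpace.generateFrom (Set.range fun p : P => {S : Spectrum P | p ∈ S.1})

end Order

section Relations

variable {P Q R : Type*} [PartialOrder P] [PartialOrder Q] [PartialOrder R]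

/-- A relation `⊐ ⊆ Q × P` is a refiner if each cap of `Q` is refined by some cap of `P`. -/
def IsRefiner (r : Q → P → Prop) : Prop :=
  ∀ C : Set Q, IsCap C → ∃ D : Set P, IsCap D ∧ ∀ d ∈ D, ∃ c ∈ C, r c d

/-- `⊐ ⊆ Q × P` is `∧`-preserving. -/
def WedgePreserving (r : Q → P → Prop) : Prop :=
  ∀ ⦃q p p' q'⦄, r q p → Compat p p' → r q' p' → Compat q q'

/-- The star of a relation: `q ⊐* p` iff `C p ⊏ q` for some cap `C` of `P`. -/
def star (r : Q → P → Prop) (q : Q) (p : P) : Prop :=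
  ∃ C : Set P, IsCap C ∧ ∀ c ∈ starOf C p, r q c

/-- Star-composition of relations, the star of the usual composition. -/
def starComp (s : R → Q → Prop) (r : Q → P → Prop) : R → P → Prop :=
  star (Relation.Comp s r)

/-- The up-closure `S^⊏` of `S ⊆ P` along a relation `⊐ ⊆ Q × P`. -/
def relUp (r : Q → P → Prop) (S : Set P) : Set Q :=
  {q | ∃ p ∈ S, r q p}

end Relations

/-! ### Basic facts about caps -/

section Caps

variable {P : Type*} [PartialOrder P]

theorem Compat.symm {p q : P} (h : Compat p q) : Compat q p :=
  let ⟨r, h1, h2⟩ := h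
  ⟨r, h2, h1⟩

theorem Compat.mono {p q p' q' : P} (h : Compat p q) (hp : p ≤ p') (hq : q ≤ q') :
    Compat p' q' :=
  let ⟨r, h1, h2⟩ := h
  ⟨r, h1.trans hp, h2.trans hq⟩

theorem Compat.refl (p : P) : Compat p p := ⟨p, le_rfl, le_rfl⟩

theorem IsCap.of_refines {C D : Set P} (hC : IsCap C) (h : ∀ c ∈ C, ∃ d ∈ D, c ≤ d) :
    IsCap D := by
  obtain ⟨B, hB, hBC⟩ := hC
  refine ⟨B, hB, fun b hb => ?_⟩
  obtain ⟨c, hc, hbc⟩ := hBC b hb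
  obtain ⟨d, hd, hcd⟩ := h c hc
  exact ⟨d, hd, hbc.trans hcd⟩

theorem IsCap.finite_subcap {C : Set P} (hC : IsCap C) :
    ∃ F ⊆ C, F.Finite ∧ IsCap F := by
  obtain ⟨B, hB, hBC⟩ := hC
  choose! f hf hbf using hBC
  exact ⟨f '' B, by rintro _ ⟨b, hb, rfl⟩; exact hf b hb, hB.1.image f, B, hB,
    fun b hb => ⟨f b, ⟨b, hb, rfl⟩, hbf b hb⟩⟩

theorem Compat.split {p q : P} (h : Compat p q) {C : Set P} (hC : IsCap C) :
    ∃ c ∈ C, Compat p c ∧ Compat c q := by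
  obtain ⟨r, hp, hq⟩ := h
  obtain ⟨B, hB, hBC⟩ := hC
  obtain ⟨b, hb, h⟩ := hB.2 r
  obtain ⟨c, hc, hbc⟩ := hBC b hb
  rcases h with h | h
  · exact ⟨c, hc, ⟨r, hp, h.trans hbc⟩, ⟨r, h.trans hbc, hq⟩⟩
  · exact ⟨c, hc, ⟨b, h.trans hp, hbc⟩, ⟨b, hbc, h.trans hq⟩⟩

theorem Compat.starAbove {p q r : P} (h : Compat p q) (hr : StarAbove r q) : Compat p r := by
  obtain ⟨C, hC, hle⟩ := hr
  obtain ⟨c, hc, hpc, hcq⟩ := h.split hC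
  exact hpc.mono le_rfl (hle c ⟨hc, hcq⟩)

theorem StarAbove.mono {p q q' : P} (h : StarAbove q p) (hq : q ≤ q') : StarAbove q' p :=
  let ⟨C, hC, hle⟩ := h
  ⟨C, hC, fun c hc => (hle c hc).trans hq⟩

/-- In an ω-poset, any two caps have a common refinement. -/
theorem IsOmega.exists_common (hP : IsOmega P) {C D : Set P} (hC : IsCap C) (hD : IsCap D) :
    ∃ A : Set P, IsCap A ∧ (∀ a ∈ A, ∃ c ∈ C, a ≤ c) ∧ ∀ a ∈ A, ∃ d ∈ D, a ≤ d := by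
  obtain ⟨B₁, hB₁, h₁⟩ := hC
  obtain ⟨B₂, hB₂, h₂⟩ := hD
  let U : Set P := ⋃ b ∈ B₁ ∪ B₂, Set.Ici b
  have hUfin : U.Finite := (hB₁.1.union hB₂.1).biUnion fun b _ => hP.1 b
  have hmemU : ∀ b ∈ B₁ ∪ B₂, ∀ p, b ≤ p → p ∈ U := fun b hb p hbp =>
    Set.mem_biUnion hb hbp
  have hUup : ∀ p ∈ U, ∀ q, p ≤ q → q ∈ U := by
    intro p hp q hpq
    obtain ⟨b, hb, hbp⟩ := Set.mem_iUnion₂.1 hp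
    exact hmemU b hb q (le_trans hbp hpq)
  let T : Set P := {p | p ∉ U ∧ ∀ q, p < q → q ∈ U}
  have hTfin : T.Finite := by
    refine ((Set.finite_Iic (U.ncard + 1)).biUnion fun n _ => hP.2 n).subset ?_
    intro p hp
    refine Set.mem_biUnion (x := (Set.Ici p).ncard) ?_ rfl
    have hsub : Set.Ici p ⊆ insert p U := by
      intro q hq
      rcases eq_or_lt_of_le (show p ≤ q from hq) with h | h
      · exact Or.inl h.symm
      · exact Or.inr (hp.2 q h)
    exact (Set.ncard_le_ncard hsub (hUfin.insert p)).trans (Set.ncard_insert_le p U)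
  have hTtop : ∀ p, p ∉ U → ∃ t ∈ T, p ≤ t := by
    intro p hp
    obtain ⟨t, ht⟩ := ((hP.1 p).subset (Set.sdiff_subset (t := U))).exists_maximal
      ⟨p, show p ≤ p from le_rfl, hp⟩
    refine ⟨t, ⟨ht.1.2, fun q htq => ?_⟩, ht.1.1⟩
    by_contra hq
    exact absurd (ht.2 ⟨le_trans (show p ≤ t from ht.1.1) htq.le, hq⟩ htq.le) htq.not_ge
  have hdown : ∀ p ∈ U, ∃ r, r ≤ p ∧ (r ∉ U ∨ ∀ s, s ≤ r → s = r) := by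
    intro p hp
    by_cases h : ∃ r, r ≤ p ∧ r ∉ U
    · obtain ⟨r, hr, hrU⟩ := h
      exact ⟨r, hr, Or.inl hrU⟩
    · push Not at h
      obtain ⟨r, hr⟩ := (hUfin.subset (fun s (hs : s ∈ Set.Iic p) => h s hs)).exists_minimal
        ⟨p, show p ≤ p from le_rfl⟩
      exact ⟨r, hr.1, Or.inr fun s hs => le_antisymm hs (hr.2 (le_trans hs hr.1) hs)⟩
  choose! f hf hf' using hdown
  have hband : IsBand (T ∪ f '' U) := by
    refine ⟨hTfin.union (hUfin.image f), fun p => ?_⟩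
    by_cases hp : p ∈ U
    · exact ⟨f p, Or.inr ⟨p, hp, rfl⟩, Or.inr (hf p hp)⟩
    · obtain ⟨t, ht, hpt⟩ := hTtop p hp
      exact ⟨t, Or.inl ht, Or.inl hpt⟩
  have hlow : ∀ a ∈ T ∪ f '' U, a ∉ U ∨ ∀ s, s ≤ a → s = a := by
    rintro a (ha | ⟨p, hp, rfl⟩)
    · exact Or.inl ha.1
    · exact hf' p hp
  have key : ∀ B ⊆ B₁ ∪ B₂, IsBand B → ∀ a ∈ T ∪ f '' U, ∃ b ∈ B, a ≤ b := by
    intro B hBsub hB a ha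
    obtain ⟨b, hb, h | h⟩ := hB.2 a
    · exact ⟨b, hb, h⟩
    · rcases hlow a ha with h' | h'
      · exact absurd (hmemU b (hBsub hb) a h) h'
      · exact ⟨b, hb, (h' b h).ge⟩
  refine ⟨T ∪ f '' U, ⟨_, hband, fun b hb => ⟨b, hb, le_rfl⟩⟩, fun a ha => ?_, fun a ha => ?_⟩
  · obtain ⟨b, hb, hab⟩ := key B₁ Set.subset_union_left hB₁ a ha
    obtain ⟨c, hc, hbc⟩ := h₁ b hb
    exact ⟨c, hc, hab.trans hbc⟩
  · obtain ⟨b, hb, hab⟩ := key B₂ Set.subset_union_right hB₂ a ha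
    obtain ⟨c, hc, hbc⟩ := h₂ b hb
    exact ⟨c, hc, hab.trans hbc⟩

theorem IsOmega.exists_common_finite (hP : IsOmega P) {ι : Type*} {F : Set ι} (hF : F.Finite)
    (D : ι → Set P) (hD : ∀ i ∈ F, IsCap (D i)) {E : Set P} (hE : IsCap E) :
    ∃ A : Set P, IsCap A ∧ ∀ i ∈ F, ∀ a ∈ A, ∃ d ∈ D i, a ≤ d := by
  induction F, hF using Set.Finite.induction_on with
  | empty => exact ⟨E, hE, by simp⟩
  | @insert i s _ _ ih =>
    obtain ⟨A, hA, h⟩ := ih fun j hj => hD j (Set.mem_insert_of_mem _ hj)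
    obtain ⟨A', hA', h1, h2⟩ := hP.exists_common hA (hD i (Set.mem_insert _ _))
    refine ⟨A', hA', fun j hj a ha => ?_⟩
    rcases Set.mem_insert_iff.1 hj with rfl | hj
    · exact h2 a ha
    · obtain ⟨b, hb, hab⟩ := h1 a ha
      obtain ⟨d, hd, hbd⟩ := h j hj b hb
      exact ⟨d, hd, hab.trans hbd⟩

end Caps

/-! ### Basic facts about stars of relations -/

section Stars

variable {P Q R S : Type*} [PartialOrder P]

theorem star_mono {r s : Q → P → Prop} (h : ∀ q p, r q p → s q p) (q : Q) (p : P)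
    (hq : star r q p) : star s q p :=
  let ⟨C, hC, hle⟩ := hq
  ⟨C, hC, fun c hc => h q c (hle c hc)⟩

/-- It suffices to find a cap whose star at `p` lies `≤`-below elements related to `q`. -/
theorem star_of_le {r : Q → P → Prop} {q : Q} {p : P} {C : Set P} (hC : IsCap C)
    (h : ∀ c ∈ starOf C p, ∃ d, c ≤ d ∧ r q d) : star r q p := by
  refine ⟨{d | Compat d p → r q d}, hC.of_refines fun c hc => ?_, fun d hd => hd.1 hd.2⟩
  by_cases hcp : Compat c p
  · obtain ⟨d, hcd, hd⟩ := h c ⟨hc, hcp⟩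
    exact ⟨d, fun _ => hd, hcd⟩
  · exact ⟨c, fun h' => absurd h' hcp, le_rfl⟩

theorem starAbove_eq : (StarAbove : P → P → Prop) = star (· = ·) := by
  funext q p
  refine propext ⟨fun ⟨C, hC, h⟩ => star_of_le hC fun c hc => ⟨q, h c hc, rfl⟩, ?_⟩
  rintro ⟨C, hC, h⟩
  exact ⟨C, hC, fun c hc => (h c hc).ge⟩

theorem star_of_comp_starAbove {r : Q → P → Prop} {q : Q} {p : P}
    (h : Relation.Comp r StarAbove q p) : star r q p := by
  obtain ⟨d, hd, C, hC, hle⟩ := h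
  exact star_of_le hC fun c hc => ⟨d, hle c hc, hd⟩

theorem star_comp_starAbove_of_star (hP : IsRegular P) {r : Q → P → Prop} {q : Q} {p : P}
    (h : star r q p) : star (Relation.Comp r StarAbove) q p := by
  obtain ⟨C, hC, h⟩ := h
  obtain ⟨B, hB, hBC⟩ := hP C hC
  refine ⟨B, hB, fun b hb => ?_⟩
  obtain ⟨c, hc, hcb⟩ := hBC b hb.1
  exact ⟨c, h c ⟨hc, (hb.2.symm.starAbove hcb).symm⟩, hcb⟩

theorem star_star (hω : IsOmega P) (hP : IsRegular P) (r : Q → P → Prop) :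
    star (star r) = star r := by
  funext q p
  refine propext ⟨?_, fun h => star_mono (fun _ _ => star_of_comp_starAbove) q p
    (star_comp_starAbove_of_star hP h)⟩
  rintro ⟨C, hC, h⟩
  obtain ⟨F, hFC, hFfin, hF⟩ := hC.finite_subcap
  have h' : ∀ c ∈ starOf F p, star r q c := fun c hc => h c ⟨hFC hc.1, hc.2⟩
  choose! D hD hDr using h'
  obtain ⟨A, hA, hAD⟩ := hω.exists_common_finite (hFfin.subset fun c (hc : c ∈ starOf F p) => hc.1)
    D hD hC
  refine star_of_le hA fun a ha => ?_
  obtain ⟨c, hc, hac, hcp⟩ := ha.2.split hF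
  obtain ⟨d, hd, had⟩ := hAD c ⟨hc, hcp⟩ a ha.1
  exact ⟨d, had, hDr c ⟨hc, hcp⟩ d ⟨hd, hac.mono had le_rfl⟩⟩

theorem star_comp_of_comp_star {s : R → Q → Prop} {r : Q → P → Prop} {x : R} {p : P}
    (h : Relation.Comp s (star r) x p) : star (Relation.Comp s r) x p := by
  obtain ⟨q, hq, C, hC, h⟩ := h
  exact ⟨C, hC, fun c hc => ⟨q, hq, h c hc⟩⟩

theorem star_comp_star (hω : IsOmega P) (hP : IsRegular P) (s : R → Q → Prop)
    (r : Q → P → Prop) : star (Relation.Comp s (star r)) = star (Relation.Comp s r) := by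
  funext x p
  refine propext ⟨fun h => ?_, fun h => ?_⟩
  · rw [← star_star hω hP]
    exact star_mono (fun _ _ => star_comp_of_comp_star) x p h
  · refine star_mono (fun y c hy => ?_) x p (star_comp_starAbove_of_star hP h)
    obtain ⟨d, ⟨q, hyq, hqd⟩, hdc⟩ := hy
    exact ⟨q, hyq, star_of_comp_starAbove ⟨d, hqd, hdc⟩⟩

variable [PartialOrder Q]

theorem star_comp_of_star_comp {s : R → Q → Prop} {r : Q → P → Prop} (hr : IsRefiner r)
    (hw : WedgePreserving r) {x : R} {p : P} (h : Relation.Comp (star s) r x p) :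
    star (Relation.Comp s r) x p := by
  obtain ⟨q, ⟨C, hC, hs⟩, hqp⟩ := h
  obtain ⟨B, hB, hBC⟩ := hr C hC
  refine ⟨B, hB, fun b hb => ?_⟩
  obtain ⟨c, hc, hcb⟩ := hBC b hb.1
  exact ⟨c, hs c ⟨hc, hw hcb hb.2 hqp⟩, hcb⟩

theorem star_star_comp (hω : IsOmega P) (hP : IsRegular P) {s : R → Q → Prop}
    {r : Q → P → Prop} (hr : IsRefiner r) (hw : WedgePreserving r)
    (hs : ∀ x q, s x q → star s x q) :
    star (Relation.Comp (star s) r) = star (Relation.Comp s r) := by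
  funext x p
  refine propext ⟨fun h => ?_, star_mono (fun y c => ?_) x p⟩
  · rw [← star_star hω hP]
    exact star_mono (fun _ _ => star_comp_of_star_comp hr hw) x p h
  · rintro ⟨q, hyq, hqc⟩
    exact ⟨q, hs y q hyq, hqc⟩

variable [PartialOrder R]

theorem isRefiner_eq : IsRefiner (fun p q : P => p = q) :=
  fun C hC => ⟨C, hC, fun c hc => ⟨c, hc, rfl⟩⟩

theorem wedgePreserving_eq : WedgePreserving (fun p q : P => p = q) := by
  rintro q _ _ q' rfl h rfl
  exact h

theorem IsRefiner.comp {s : R → Q → Prop} {r : Q → P → Prop} (hs : IsRefiner s)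
    (hr : IsRefiner r) : IsRefiner (Relation.Comp s r) := by
  intro C hC
  obtain ⟨D, hD, h⟩ := hs C hC
  obtain ⟨E, hE, h'⟩ := hr D hD
  refine ⟨E, hE, fun e he => ?_⟩
  obtain ⟨d, hd, hde⟩ := h' e he
  obtain ⟨c, hc, hcd⟩ := h d hd
  exact ⟨c, hc, d, hcd, hde⟩

theorem WedgePreserving.comp {s : R → Q → Prop} {r : Q → P → Prop} (hs : WedgePreserving s)
    (hr : WedgePreserving r) : WedgePreserving (Relation.Comp s r) := by
  rintro x p p' x' ⟨q, hx, hq⟩ h ⟨q', hx', hq'⟩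
  exact hs hx (hr hq h hq') hx'

theorem IsRefiner.star (hP : IsRegular P) {r : Q → P → Prop} (hr : IsRefiner r) :
    IsRefiner (star r) := by
  intro C hC
  obtain ⟨D, hD, h⟩ := hr C hC
  obtain ⟨E, hE, h'⟩ := hP D hD
  refine ⟨E, hE, fun e he => ?_⟩
  obtain ⟨d, hd, hde⟩ := h' e he
  obtain ⟨c, hc, hcd⟩ := h d hd
  exact ⟨c, hc, star_of_comp_starAbove ⟨d, hcd, hde⟩⟩

theorem WedgePreserving.star {r : Q → P → Prop} (hr : WedgePreserving r) :
    WedgePreserving (star r) := by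
  rintro q p p' q' ⟨C, hC, h⟩ hpp ⟨C', hC', h'⟩
  obtain ⟨c, hc, hpc, hcp⟩ := hpp.split hC
  obtain ⟨c', hc', hcc, hcp'⟩ := hcp.split hC'
  exact hr (h c ⟨hc, hpc.symm⟩) hcc (h' c' ⟨hc', hcp'⟩)

theorem isRefiner_starAbove (hP : IsRegular P) :
    IsRefiner (StarAbove : P → P → Prop) := by
  rw [starAbove_eq]
  exact isRefiner_eq.star hP

theorem wedgePreserving_starAbove : WedgePreserving (StarAbove : P → P → Prop) := by
  rw [starAbove_eq]
  exact wedgePreserving_eq.star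

theorem starComp_starAbove (hω : IsOmega P) (hP : IsRegular P) (r : Q → P → Prop) :
    starComp r StarAbove = star r := by
  rw [starComp, starAbove_eq, star_comp_star hω hP, Relation.comp_eq]

theorem starAbove_starComp_starAbove (hω : IsOmega P) (hP : IsRegular P) :
    starComp StarAbove StarAbove = (StarAbove : P → P → Prop) := by
  rw [starComp_starAbove hω hP, starAbove_eq, star_star hω hP]

/-- `▷ * ⊐` satisfies the equation of strong refiners. -/
theorem starComp_idem (hω : IsOmega P) (hP : IsRegular P) (hω' : IsOmega Q)
    (hQ : IsRegular Q) {r : Q → P → Prop} (hr : IsRefiner r) (hw : WedgePreserving r) :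
    starComp StarAbove (starComp StarAbove r) = starComp StarAbove r := by
  have h1 : ∀ x y : Q, Relation.Comp StarAbove StarAbove x y →
      star (Relation.Comp StarAbove StarAbove) x y := by
    intro x y h
    have h2 := starAbove_starComp_starAbove hω' hQ
    rw [starComp] at h2
    rw [h2, starAbove_eq, ← star_star hω' hQ, ← starAbove_eq]
    exact star_of_comp_starAbove h
  have h3 := star_star_comp hω hP hr hw h1
  have h2 := starAbove_starComp_starAbove hω' hQ
  unfold starComp at h2 ⊢
  rw [star_comp_star hω hP, ← Relation.comp_assoc, ← h3, h2]

/-- Strong refiners are star-invariant. -/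
theorem star_eq_of_strong (hω : IsOmega P) (hP : IsRegular P) {r : Q → P → Prop}
    (h : r = starComp StarAbove r) : star r = r := by
  conv_lhs => rw [h, starComp, star_star hω hP]
  exact h.symm

theorem starComp_strong (hω : IsOmega P) (hP : IsRegular P) (hω' : IsOmega Q)
    (hQ : IsRegular Q) {s : R → Q → Prop} {r : Q → P → Prop}
    (hr : IsRefiner r) (hw : WedgePreserving r) (hs : s = starComp StarAbove s) :
    starComp s r = starComp StarAbove (starComp s r) := by
  have h1 : ∀ x q, Relation.Comp StarAbove s x q → star (Relation.Comp StarAbove s) x q := by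
    intro x q h
    rw [← star_eq_of_strong hω' hQ hs] at h
    exact star_comp_of_comp_star h
  have h2 := star_star_comp hω hP hr hw h1
  unfold starComp at hs ⊢
  rw [star_comp_star hω hP, ← Relation.comp_assoc, ← h2, ← hs]

theorem starComp_assoc (hω : IsOmega P) (hP : IsRegular P) (hω' : IsOmega Q)
    (hQ : IsRegular Q) {t : S → R → Prop} {s : R → Q → Prop} {r : Q → P → Prop}
    (hr : IsRefiner r) (hw : WedgePreserving r) (hs : s = starComp StarAbove s) :
    starComp t (starComp s r) = starComp (starComp t s) r := by
  have h1 : ∀ x q, Relation.Comp t s x q → star (Relation.Comp t s) x q := by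
    intro x q h
    rw [← star_eq_of_strong hω' hQ hs] at h
    exact star_comp_of_comp_star h
  unfold starComp
  rw [star_comp_star hω hP, star_star_comp hω hP hr hw h1, Relation.comp_assoc]

end Stars

/-! ### Basic facts about the spectrum -/

section Spectra

variable {P Q : Type*} [PartialOrder P] [PartialOrder Q]

theorem isSelector_iff_not_isCap_compl {S : Set P} : IsSelector S ↔ ¬ IsCap Sᶜ := by
  constructor
  · intro h hc
    obtain ⟨x, hx, hx'⟩ := h _ hc
    exact hx' hx
  · intro h C hC
    by_contra hne
    refine h (hC.of_refines fun c hc => ⟨c, fun hcS => hne ⟨c, hcS, hc⟩, le_rfl⟩)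

theorem IsSelector.exists_minimal {S : Set P} (hS : IsSelector S) :
    ∃ T ⊆ S, Minimal IsSelector T := by
  obtain ⟨T, hTS, hT⟩ := zorn_superset_nonempty {T : Set P | IsSelector T} (by
    intro c hc hchain hne
    refine ⟨⋂₀ c, ?_, fun s hs => Set.sInter_subset_of_mem hs⟩
    intro C hC
    obtain ⟨F, hFC, hFfin, hF⟩ := hC.finite_subcap
    by_contra hempty
    have hex : ∀ x ∈ F, ∃ s ∈ c, x ∉ s := by
      intro x hx
      by_contra hcon
      push Not at hcon
      exact hempty ⟨x, fun s hs => hcon s hs, hFC hx⟩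
    have hsel : ∀ G : Set P, G.Finite → (∀ x ∈ G, ∃ s ∈ c, x ∉ s) →
        ∃ s ∈ c, ∀ x ∈ G, x ∉ s := by
      intro G hG
      induction G, hG using Set.Finite.induction_on with
      | empty =>
        intro _
        obtain ⟨s, hs⟩ := hne
        exact ⟨s, hs, by simp⟩
      | @insert x G _ _ ih =>
        intro h
        obtain ⟨s, hs, hsG⟩ := ih fun y hy => h y (Set.mem_insert_of_mem _ hy)
        obtain ⟨t, ht, hxt⟩ := h x (Set.mem_insert _ _)
        rcases hchain.total hs ht with hst | hts
        · exact ⟨s, hs, fun y hy => (Set.mem_insert_iff.1 hy).elim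
            (fun hyx => hyx ▸ fun hxs => hxt (hst hxs)) (hsG y)⟩
        · exact ⟨t, ht, fun y hy => (Set.mem_insert_iff.1 hy).elim
            (fun hyx => hyx ▸ hxt) (fun hyG hyt => hsG y hyG (hts hyt))⟩
    obtain ⟨s, hs, hsF⟩ := hsel F hFfin hex
    obtain ⟨x, hxs, hxF⟩ := hc hs F hF
    exact hsF x hxF hxs) S hS
  exact ⟨T, hTS, hT⟩

theorem exists_cap_of_minimal {S : Set P} (hS : Minimal IsSelector S) {s : P} (hs : s ∈ S) :
    ∃ C : Set P, IsCap C ∧ ∀ c ∈ C, c ∈ S → c = s := by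
  by_contra hcon
  push Not at hcon
  have hsel : IsSelector (S \ {s}) := by
    intro C hC
    obtain ⟨c, hc, hcS, hcs⟩ := hcon C hC
    exact ⟨c, ⟨hcS, hcs⟩, hc⟩
  exact (hS.2 hsel Set.sdiff_subset hs).2 rfl

theorem mem_of_le_of_minimal {S : Set P} (hS : Minimal IsSelector S) {s p : P} (hs : s ∈ S)
    (hp : s ≤ p) : p ∈ S := by
  obtain ⟨C, hC, h⟩ := exists_cap_of_minimal hS hs
  have hD : IsCap ({c | c ∈ C ∧ c ≠ s} ∪ {p}) := hC.of_refines fun c hc => by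
    by_cases hcs : c = s
    · exact ⟨p, Or.inr rfl, hcs ▸ hp⟩
    · exact ⟨c, Or.inl ⟨hc, hcs⟩, le_rfl⟩
  obtain ⟨d, hdS, hd | hd⟩ := hS.1 _ hD
  · exact absurd (h d hd.1 hdS) hd.2
  · exact (show d = p from hd) ▸ hdS

/-- Minimal selectors in an ω-poset are linked. -/
theorem compat_of_minimal (hω : IsOmega P) {S : Set P} (hS : Minimal IsSelector S) {p q : P}
    (hp : p ∈ S) (hq : q ∈ S) : Compat p q := by
  obtain ⟨C, hC, h⟩ := exists_cap_of_minimal hS hp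
  obtain ⟨D, hD, h'⟩ := exists_cap_of_minimal hS hq
  obtain ⟨A, hA, hAC, hAD⟩ := hω.exists_common hC hD
  obtain ⟨a, haS, haA⟩ := hS.1 A hA
  obtain ⟨c, hc, hac⟩ := hAC a haA
  obtain ⟨d, hd, had⟩ := hAD a haA
  exact ⟨a, h c hc (mem_of_le_of_minimal hS haS hac) ▸ hac,
    h' d hd (mem_of_le_of_minimal hS haS had) ▸ had⟩

/-- Minimal selectors in a regular ω-poset are round. -/
theorem round_of_minimal (hω : IsOmega P) (hP : IsRegular P) {S : Set P}
    (hS : Minimal IsSelector S) {p : P} (hp : p ∈ S) : ∃ q ∈ S, StarAbove p q := by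
  obtain ⟨C, hC, h⟩ := exists_cap_of_minimal hS hp
  obtain ⟨D, hD, hDC⟩ := hP C hC
  obtain ⟨d, hdS, hdD⟩ := hS.1 D hD
  obtain ⟨c, hc, hcd⟩ := hDC d hdD
  have hcS : c ∈ S := by
    obtain ⟨E, hE, hle⟩ := hcd
    obtain ⟨e, heS, heE⟩ := hS.1 E hE
    exact mem_of_le_of_minimal hS heS (hle e ⟨heE, compat_of_minimal hω hS heS hdS⟩)
  exact ⟨d, hdS, h c hc hcS ▸ hcd⟩

/-- In a regular poset, linked selectors yield minimal selectors by taking up-closures with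
respect to the star-below relation. -/
theorem minimal_starUp (hP : IsRegular P) {S : Set P} (hS : IsSelector S)
    (hl : ∀ p ∈ S, ∀ q ∈ S, Compat p q) : Minimal IsSelector (starUp S) := by
  have hlink : ∀ p ∈ S, ∀ q ∈ starUp S, Compat p q := by
    rintro p hp q ⟨s, hs, hqs⟩
    exact (hl p hp s hs).starAbove hqs
  have hlink' : ∀ p ∈ starUp S, ∀ q ∈ starUp S, Compat p q := by
    rintro p hp q ⟨s, hs, hqs⟩
    exact (hlink s hs p hp).symm.starAbove hqs
  have hsel : IsSelector (starUp S) := by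
    intro C hC
    obtain ⟨B, hB, hBC⟩ := hP C hC
    obtain ⟨b, hbS, hbB⟩ := hS B hB
    obtain ⟨c, hc, hcb⟩ := hBC b hbB
    exact ⟨c, ⟨b, hbS, hcb⟩, hc⟩
  refine ⟨hsel, fun T hT hTS t ht => ?_⟩
  obtain ⟨s, hs, C, hC, hle⟩ := ht
  obtain ⟨B, hB, hBC⟩ := hP C hC
  obtain ⟨b, hbS, hbB⟩ := hsel B hB
  obtain ⟨c, hc, hcb⟩ := hBC b hbB
  have hcs : Compat c s := ((hlink s hs b hbS).starAbove hcb).symm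
  obtain ⟨D, hD, hDle⟩ := hcb.mono (hle c ⟨hc, hcs⟩)
  have hE : IsCap ({d | d ∈ D ∧ ¬ Compat d b} ∪ {t}) := hD.of_refines fun d hd => by
    by_cases hdb : Compat d b
    · exact ⟨t, Or.inr rfl, hDle d ⟨hd, hdb⟩⟩
    · exact ⟨d, Or.inl ⟨hd, hdb⟩, le_rfl⟩
  obtain ⟨e, heT, he | he⟩ := hT _ hE
  · exact absurd (hlink' e (hTS heT) b hbS) he.2
  · exact (show e = t from he) ▸ heT

theorem compactSpace_spectrum : CompactSpace (Spectrum P) := by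
  refine compactSpace_generateFrom rfl fun 𝒰 h𝒰 hcov => ?_
  let C : Set P := {p | {S : Spectrum P | p ∈ S.1} ∈ 𝒰}
  have hC : IsCap C := by
    by_contra hC
    have hsel : IsSelector Cᶜ := by rwa [isSelector_iff_not_isCap_compl, compl_compl]
    obtain ⟨T, hTC, hT⟩ := hsel.exists_minimal
    have hmem : (⟨T, hT⟩ : Spectrum P) ∈ ⋃₀ 𝒰 := hcov ▸ Set.mem_univ _
    obtain ⟨U, hU, hTU⟩ := hmem
    obtain ⟨p, rfl⟩ := h𝒰 hU
    exact hTC hTU hU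
  obtain ⟨F, hFC, hFfin, hF⟩ := hC.finite_subcap
  refine ⟨(fun p : P => {S : Spectrum P | p ∈ S.1}) '' F, ?_, hFfin.image _, ?_⟩
  · rintro _ ⟨p, hp, rfl⟩
    exact hFC hp
  · refine Set.eq_univ_of_forall fun S => ?_
    obtain ⟨p, hpS, hpF⟩ := S.2.1 F hF
    exact ⟨_, ⟨p, hpF, rfl⟩, hpS⟩

theorem isOpen_basic (p : P) : IsOpen {S : Spectrum P | p ∈ S.1} :=
  TopologicalSpace.isOpen_generateFrom_of_mem ⟨p, rfl⟩

theorem t2Space_spectrum (hω : IsOmega P) (hP : IsRegular P) : T2Space (Spectrum P) := by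
  refine ⟨fun S T hST => ?_⟩
  have hnot : ¬ S.1 ⊆ T.1 := fun h => hST (Spectrum.ext (h.antisymm (T.2.2 S.2.1 h)))
  obtain ⟨s, hsS, hsT⟩ := Set.not_subset.1 hnot
  obtain ⟨t, htS, C, hC, hle⟩ := round_of_minimal hω hP S.2 hsS
  obtain ⟨c, hcT, hc⟩ := T.2.1 C hC
  refine ⟨_, _, isOpen_basic t, isOpen_basic c, htS, hcT, ?_⟩
  rw [Set.disjoint_left]
  intro U hUt hUc
  exact hsT (mem_of_le_of_minimal T.2 hcT (hle c ⟨hc, compat_of_minimal hω U.2 hUc hUt⟩))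

theorem secondCountable_spectrum (hω : IsOmega P) :
    SecondCountableTopology (Spectrum P) := by
  have : Countable P := by
    rw [← Set.countable_univ_iff]
    refine (Set.countable_iUnion fun n : ℕ => (hω.2 n).countable).mono fun p _ => ?_
    exact Set.mem_iUnion.2 ⟨(Set.Ici p).ncard, rfl⟩
  exact ⟨_, Set.countable_range _, rfl⟩

theorem metrizableSpace_spectrum (hω : IsOmega P) (hP : IsRegular P) :
    TopologicalSpace.MetrizableSpace (Spectrum P) := by
  have := compactSpace_spectrum (P := P)
  have := t2Space_spectrum hω hP
  have := secondCountable_spectrum hω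
  infer_instance

theorem minimal_phi (hω : IsOmega P) (hQ : IsRegular Q) {r : Q → P → Prop} (hr : IsRefiner r)
    (hw : WedgePreserving r) (S : Spectrum P) :
    Minimal IsSelector (starUp (relUp r S.1)) := by
  refine minimal_starUp hQ (fun C hC => ?_) ?_
  · obtain ⟨D, hD, h⟩ := hr C hC
    obtain ⟨d, hdS, hd⟩ := S.2.1 D hD
    obtain ⟨c, hc, hcd⟩ := h d hd
    exact ⟨c, ⟨d, hdS, hcd⟩, hc⟩
  · rintro q ⟨p, hp, hqp⟩ q' ⟨p', hp', hqp'⟩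
    exact hw hqp (compat_of_minimal hω S.2 hp hp') hqp'

/-- The continuous map `φ_⊐ : S P → S Q` given by `φ_⊐(S) = S^{⊏◁}`. -/
def phi (hω : IsOmega P) (hQ : IsRegular Q) (r : Q → P → Prop) (hr : IsRefiner r)
    (hw : WedgePreserving r) : C(Spectrum P, Spectrum Q) where
  toFun S := ⟨starUp (relUp r S.1), minimal_phi hω hQ hr hw S⟩
  continuous_toFun := by
    refine continuous_generateFrom_iff.2 ?_
    rintro _ ⟨q, rfl⟩
    have : (fun S : Spectrum P =>
          (⟨starUp (relUp r S.1), minimal_phi hω hQ hr hw S⟩ : Spectrum Q)) ⁻¹'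
        {T : Spectrum Q | q ∈ T.1} =
        ⋃ (p : P) (_ : Relation.Comp StarAbove r q p), {S : Spectrum P | p ∈ S.1} := by
      ext S
      simp only [Set.mem_iUnion]
      constructor
      · rintro ⟨q', ⟨p, hp, hr'⟩, hq⟩
        exact ⟨p, ⟨q', hq, hr'⟩, hp⟩
      · rintro ⟨p, ⟨q', hq, hr'⟩, hp⟩
        exact ⟨q', ⟨p, hp, hr'⟩, hq⟩
    exact (congrArg IsOpen this).mpr
      (isOpen_iUnion fun p => isOpen_iUnion fun _ => isOpen_basic p)

end Spectra

/-! ### The categories -/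

/-- Regular prime ω-posets, the objects of the category `P` of regular prime ω-posets and
`∧`-preserving refiners. -/
structure CatP : Type (u + 1) where
  carrier : Type u
  [order : PartialOrder carrier]
  omega : IsOmega carrier
  regular : IsRegular carrier
  prime : IsPrime carrier

instance : CoeSort CatP.{u} (Type u) := ⟨CatP.carrier⟩

instance (X : CatP.{u}) : PartialOrder X := X.order

/-- A morphism from `X` to `Y` in `P` is a `∧`-preserving refiner `⊐ ⊆ Y × X`. -/
@[ext]
structure WedgeRefiner (X Y : CatP.{u}) where
  rel : Y → X → Prop
  isRefiner : IsRefiner rel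
  wedgePreserving : WedgePreserving rel

/-- The category `P`, with the usual composition of relations. -/
instance : Category CatP.{u} where
  Hom := WedgeRefiner
  id _ := ⟨(· = ·), isRefiner_eq, wedgePreserving_eq⟩
  comp f g := ⟨Relation.Comp g.rel f.rel, g.isRefiner.comp f.isRefiner,
    g.wedgePreserving.comp f.wedgePreserving⟩
  id_comp _ := WedgeRefiner.ext Relation.comp_eq
  comp_id _ := WedgeRefiner.ext Relation.eq_comp
  assoc _ _ _ := WedgeRefiner.ext Relation.comp_assoc.symm

/-- The category `S` has the same objects as `P`. -/
structure CatS : Type (u + 1) where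
  poset : CatP.{u}

/-- A morphism from `X` to `Y` in `S` is a strong refiner, i.e. a `∧`-preserving refiner
`⊐ ⊆ Y × X` such that `⊐ = ▷ * ⊐`. -/
@[ext]
structure StrongRefiner (X Y : CatP.{u}) extends WedgeRefiner X Y where
  strong : rel = starComp StarAbove rel

/-- The category `S`, with star-composition and with the star-above relations as identities. -/
instance : Category CatS.{u} where
  Hom X Y := StrongRefiner X.poset Y.poset
  id X := {
    rel := StarAbove
    isRefiner := isRefiner_starAbove X.poset.regular
    wedgePreserving := wedgePreserving_starAbove
    strong := (starAbove_starComp_starAbove X.poset.omega X.poset.regular).symm }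
  comp {X Y _} f g := {
    rel := starComp g.rel f.rel
    isRefiner := (g.isRefiner.comp f.isRefiner).star X.poset.regular
    wedgePreserving := (g.wedgePreserving.comp f.wedgePreserving).star
    strong := starComp_strong X.poset.omega X.poset.regular Y.poset.omega Y.poset.regular
      f.isRefiner f.wedgePreserving g.strong }
  id_comp {X _} f := StrongRefiner.ext <|
    (starComp_starAbove X.poset.omega X.poset.regular f.rel).trans
      (star_eq_of_strong X.poset.omega X.poset.regular f.strong)
  comp_id f := StrongRefiner.ext f.strong.symm
  assoc {W X _ _} f g _ := StrongRefiner.ext <|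
    starComp_assoc W.poset.omega W.poset.regular X.poset.omega X.poset.regular
      f.isRefiner f.wedgePreserving g.strong

/-- The category `K` of metrisable compact spaces and continuous maps. -/
abbrev CatK : Type (u + 1) :=
  CompHausLike.{u} fun X => TopologicalSpace.MetrizableSpace X

/-- The spectrum of a regular prime ω-poset as an object of `K`. -/
def spectrumObj (X : CatP.{u}) : CatK.{u} :=
  letI := compactSpace_spectrum (P := X)
  letI := t2Space_spectrum X.omega X.regular
  letI : CompHausLike.HasProp (fun X => TopologicalSpace.MetrizableSpace X) (Spectrum X) :=
    ⟨metrizableSpace_spectrum X.omega X.regular⟩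
  CompHausLike.of _ (Spectrum X)

/-- The morphism `φ_⊐` of `K` given by a `∧`-preserving refiner. -/
def spectrumMap {X Y : CatP.{u}} (f : WedgeRefiner X Y) : spectrumObj X ⟶ spectrumObj Y :=
  ConcreteCategory.ofHom (X := spectrumObj X) (Y := spectrumObj Y)
    (phi X.omega Y.regular f.rel f.isRefiner f.wedgePreserving)

/-- The map `S` from `P` to `K`, on objects and morphisms. -/
def spectrumP : CatP.{u} ⥤q CatK.{u} where
  obj X := spectrumObj X
  map f := spectrumMap f

/-- The restriction of the map `S` to the objects and morphisms of `S`. -/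
def spectrumS : CatS.{u} ⥤q CatK.{u} where
  obj X := spectrumObj X.poset
  map f := spectrumMap f.toWedgeRefiner

/-- The map `Q` from `P` to `S` with `Q(⊐) = ▷ * ⊐`. -/
def quotientMap : CatP.{u} ⥤q CatS.{u} where
  obj X := ⟨X⟩
  map {X Y} f := {
    rel := starComp StarAbove f.rel
    isRefiner := ((isRefiner_starAbove Y.regular).comp f.isRefiner).star X.regular
    wedgePreserving := (wedgePreserving_starAbove.comp f.wedgePreserving).star
    strong := (starComp_idem X.omega X.regular Y.omega Y.regular f.isRefiner
      f.wedgePreserving).symm }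

end OmegaPoset

/-!
A cap is exactly a set `C` such that the sets `c^∈`, `c ∈ C`, cover the spectrum. Consequently
stars of relations can be computed pointwise: `q ⊐* p` holds if and only if `q ∈ S^⊏` for every
point `S` in the set `compatPoints p` of points whose elements are all compatible with `p`. In
particular `▷ * ⊐` relates `q` to `p` exactly if `φ_⊐` maps `compatPoints p` into `q^∈`, so a strong
refiner can be recovered from its map, and the same formula applied to an arbitrary continuous map
gives a strong refiner inducing it. Functoriality rests on the fact that, in a regular ω-poset, two
minimal selectors are equal if every element of one is compatible with every element of the other.

Every compact metrisable space is a spectrum: choose a sequence of finite covers by balls of radii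
tending to `0`, each cover refining its predecessor, and order pairs (level, ball) by strict
increase of the level together with containment of the closure.
-/

namespace OmegaPoset

open Filter Topology TopologicalSpace

/-! ### Linked sets and points of the spectrum -/

section SpectrumPoints

variable {P Q : Type*} [PartialOrder P]

/-- Two subsets are linked if every element of one is compatible with every element of the other.
This relation is used to recognise when two points of a spectrum are equal. -/
def Linked (A B : Set P) : Prop :=
  ∀ a ∈ A, ∀ b ∈ B, Compat a b

theorem Linked.symm {A B : Set P} (h : Linked A B) : Linked B A :=
  fun b hb a ha => (h a ha b hb).symm

theorem Linked.starUp_left {A B : Set P} (h : Linked A B) : Linked (starUp A) B := by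
  rintro p ⟨a, ha, hpa⟩ b hb
  exact ((h a ha b hb).symm.starAbove hpa).symm

/-- The points of the spectrum all of whose elements are compatible with `p`. In a prime ω-poset
this is the closure of `p^∈`; without primeness it may be larger, and it is this larger set that
describes stars of relations. -/
def compatPoints (p : P) : Set (Spectrum P) :=
  {S | ∀ s ∈ S.1, Compat s p}

theorem isCap_iff_forall_spectrum {C : Set P} :
    IsCap C ↔ ∀ S : Spectrum P, (S.1 ∩ C).Nonempty := by
  refine ⟨fun hC S => S.2.1 C hC, fun h => ?_⟩
  by_contra hC
  have hsel : IsSelector Cᶜ := by rwa [isSelector_iff_not_isCap_compl, compl_compl]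
  obtain ⟨T, hTC, hT⟩ := hsel.exists_minimal
  obtain ⟨c, hcT, hcC⟩ := h ⟨T, hT⟩
  exact hTC hcT hcC

theorem star_iff_forall_compatPoints {r : Q → P → Prop} {q : Q} {p : P} :
    star r q p ↔ ∀ S ∈ compatPoints p, q ∈ relUp r S.1 := by
  constructor
  · rintro ⟨C, hC, hr⟩ S hS
    obtain ⟨c, hcS, hcC⟩ := S.2.1 C hC
    exact ⟨c, hcS, hr c ⟨hcC, hS c hcS⟩⟩
  · intro h
    refine ⟨{c | Compat c p → r q c}, isCap_iff_forall_spectrum.2 fun S => ?_,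
      fun c hc => hc.1 hc.2⟩
    by_cases hS : S ∈ compatPoints p
    · obtain ⟨s, hs, hqs⟩ := h S hS
      exact ⟨s, hs, fun _ => hqs⟩
    · obtain ⟨s, hs, hsp⟩ : ∃ s ∈ S.1, ¬ Compat s p := by
        simpa only [compatPoints, Set.mem_ofPred_eq, not_forall, exists_prop] using hS
      exact ⟨s, hs, fun h => absurd h hsp⟩

theorem starAbove_iff_forall_compatPoints {p q : P} :
    StarAbove q p ↔ ∀ S ∈ compatPoints p, q ∈ S.1 := by
  simp only [starAbove_eq, star_iff_forall_compatPoints, relUp, Set.mem_ofPred_eq,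
    exists_eq_right']

namespace Spectrum

theorem linked_self (hω : IsOmega P) (S : Spectrum P) : Linked S.1 S.1 :=
  fun _ hp _ hq => compat_of_minimal hω S.2 hp hq

theorem mem_compatPoints (hω : IsOmega P) {S : Spectrum P} {p : P} (hp : p ∈ S.1) :
    S ∈ compatPoints p :=
  fun s hs => S.linked_self hω s hs p hp

theorem mem_of_starAbove (hω : IsOmega P) {S : Spectrum P} {p q : P} (hqp : StarAbove q p)
    (hp : p ∈ S.1) : q ∈ S.1 :=
  starAbove_iff_forall_compatPoints.1 hqp S (mem_compatPoints hω hp)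

theorem eq_of_linked (hω : IsOmega P) (hP : IsRegular P) {S T : Spectrum P}
    (h : Linked S.1 T.1) : S = T := by
  have hST : S.1 ⊆ T.1 := fun s hs => by
    obtain ⟨s', hs', hss'⟩ := round_of_minimal hω hP S.2 hs
    exact starAbove_iff_forall_compatPoints.1 hss' T fun t ht => h.symm t ht s' hs'
  exact Spectrum.ext (hST.antisymm (T.2.2 S.2.1 hST))

theorem relUp_star_subset (hω : IsOmega P) (r : Q → P → Prop) (S : Spectrum P) :
    relUp (star r) S.1 ⊆ relUp r S.1 := by
  rintro q ⟨p, hp, hqp⟩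
  exact star_iff_forall_compatPoints.1 hqp S (mem_compatPoints hω hp)

theorem directedOn_ge (hω : IsOmega P) (S : Spectrum P) : DirectedOn (· ≥ ·) S.1 := by
  intro p hp q hq
  obtain ⟨C, hC, hCp⟩ := exists_cap_of_minimal S.2 hp
  obtain ⟨D, hD, hDq⟩ := exists_cap_of_minimal S.2 hq
  obtain ⟨A, hA, hAC, hAD⟩ := hω.exists_common hC hD
  obtain ⟨a, haS, haA⟩ := S.2.1 A hA
  obtain ⟨c, hc, hac⟩ := hAC a haA
  obtain ⟨d, hd, had⟩ := hAD a haA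
  have hcp : c = p := hCp c hc (mem_of_le_of_minimal S.2 haS hac)
  have hdq : d = q := hDq d hd (mem_of_le_of_minimal S.2 haS had)
  exact ⟨a, haS, hcp ▸ hac, hdq ▸ had⟩

end Spectrum

theorem IsOmega.isCap_univ (hω : IsOmega P) : IsCap (Set.univ : Set P) := by
  have hband : IsBand {p : P | (Set.Ici p).ncard = 1} := by
    refine ⟨hω.2 1, fun p => ?_⟩
    obtain ⟨m, hpm, hm⟩ := (hω.1 p).exists_le_maximal (Set.self_mem_Ici (a := p))
    have hm_max : IsMax m := fun q hmq => hm.2 (hpm.trans hmq) hmq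
    exact ⟨m, by rw [Set.mem_ofPred_eq, hm_max.Ici_eq, Set.ncard_singleton], Or.inl hpm⟩
  exact ⟨_, hband, fun b _ => ⟨b, Set.mem_univ b, le_rfl⟩⟩

theorem isTopologicalBasis_spectrum (hω : IsOmega P) :
    IsTopologicalBasis (Set.range fun p : P => {S : Spectrum P | p ∈ S.1}) where
  exists_subset_inter := by
    rintro _ ⟨p, rfl⟩ _ ⟨q, rfl⟩ S ⟨hp, hq⟩
    obtain ⟨a, ha, hap, haq⟩ := S.directedOn_ge hω p hp q hq
    exact ⟨_, ⟨a, rfl⟩, ha, fun T hT =>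
      ⟨mem_of_le_of_minimal T.2 hT hap, mem_of_le_of_minimal T.2 hT haq⟩⟩
  sUnion_eq := Set.eq_univ_of_forall fun S =>
    let ⟨p, hp, _⟩ := S.2.1 _ hω.isCap_univ
    ⟨_, ⟨p, rfl⟩, hp⟩
  eq_generateFrom := rfl

end SpectrumPoints

/-! ### Continuous maps and refiners -/

section ContinuousMaps

variable {P Q R : Type*} [PartialOrder P] [PartialOrder Q] [PartialOrder R]

theorem phi_eq_iff_linked (hω : IsOmega P) (hω' : IsOmega Q) (hQ : IsRegular Q)
    {r : Q → P → Prop} (hr : IsRefiner r) (hw : WedgePreserving r) {S : Spectrum P}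
    {T : Spectrum Q} : phi hω hQ r hr hw S = T ↔ Linked (relUp r S.1) T.1 := by
  refine ⟨?_, fun h => Spectrum.eq_of_linked hω' hQ h.starUp_left⟩
  rintro rfl
  have hlinked : Linked (relUp r S.1) (relUp r S.1) := by
    rintro q ⟨p, hp, hqp⟩ q' ⟨p', hp', hqp'⟩
    exact hw hqp (S.linked_self hω p hp p' hp') hqp'
  exact hlinked.starUp_left.symm

theorem phi_id (hω : IsOmega P) (hP : IsRegular P) :
    phi hω hP (· = ·) isRefiner_eq wedgePreserving_eq = ContinuousMap.id (Spectrum P) := by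
  refine ContinuousMap.ext fun S => (phi_eq_iff_linked hω hω hP _ _).2 ?_
  rintro _ ⟨p, hp, rfl⟩
  exact S.linked_self hω _ hp

theorem phi_starAbove (hω : IsOmega P) (hP : IsRegular P) :
    phi hω hP StarAbove (isRefiner_starAbove hP) wedgePreserving_starAbove =
      ContinuousMap.id (Spectrum P) := by
  refine ContinuousMap.ext fun S => (phi_eq_iff_linked hω hω hP _ _).2 ?_
  rintro q ⟨p, hp, hqp⟩
  exact S.linked_self hω q (Spectrum.mem_of_starAbove hω hqp hp)

theorem phi_star (hω : IsOmega P) (hP : IsRegular P) (hω' : IsOmega Q) (hQ : IsRegular Q)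
    {r : Q → P → Prop} (hr : IsRefiner r) (hw : WedgePreserving r) :
    phi hω hQ (star r) (hr.star hP) hw.star = phi hω hQ r hr hw := by
  refine ContinuousMap.ext fun S => (phi_eq_iff_linked hω hω' hQ _ _).2 fun q hq => ?_
  exact (phi_eq_iff_linked hω hω' hQ hr hw).1 rfl q (S.relUp_star_subset hω r hq)

theorem phi_comp (hω : IsOmega P) (hω' : IsOmega Q) (hQ : IsRegular Q) (hω'' : IsOmega R)
    (hR : IsRegular R) {s : R → Q → Prop} (hs : IsRefiner s) (hsw : WedgePreserving s)
    {r : Q → P → Prop} (hr : IsRefiner r) (hrw : WedgePreserving r) :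
    phi hω hR (Relation.Comp s r) (hs.comp hr) (hsw.comp hrw) =
      (phi hω' hR s hs hsw).comp (phi hω hQ r hr hrw) := by
  refine ContinuousMap.ext fun S => (phi_eq_iff_linked hω hω'' hR _ _).2 ?_
  have hlinked : Linked (relUp r S.1) (phi hω hQ r hr hrw S).1 :=
    (phi_eq_iff_linked hω hω' hQ hr hrw).1 rfl
  rintro x ⟨p, hp, q, hxq, hqp⟩ y ⟨x', ⟨q', hq', hx'q'⟩, hyx'⟩
  have hqq' : Compat q q' := hlinked q ⟨p, hp, hqp⟩ q' hq'
  exact (hsw hxq hqq' hx'q').starAbove hyx'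

theorem phi_starComp (hω : IsOmega P) (hP : IsRegular P) (hω' : IsOmega Q) (hQ : IsRegular Q)
    (hω'' : IsOmega R) (hR : IsRegular R) {s : R → Q → Prop} (hs : IsRefiner s)
    (hsw : WedgePreserving s) {r : Q → P → Prop} (hr : IsRefiner r) (hrw : WedgePreserving r) :
    phi hω hR (starComp s r) ((hs.comp hr).star hP) (hsw.comp hrw).star =
      (phi hω' hR s hs hsw).comp (phi hω hQ r hr hrw) :=
  (phi_star hω hP hω'' hR (hs.comp hr) (hsw.comp hrw)).trans
    (phi_comp hω hω' hQ hω'' hR hs hsw hr hrw)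

/-- The relation induced by a map `f` of spectra: `q` is related to `p` if `f` maps `compatPoints p`
into `q^∈`. For continuous `f` between spectra of regular prime ω-posets this is the strong refiner
inducing `f`. -/
def mapRel (f : Spectrum P → Spectrum Q) (q : Q) (p : P) : Prop :=
  ∀ S ∈ compatPoints p, q ∈ (f S).1

theorem relUp_mapRel_subset (hω : IsOmega P) (f : Spectrum P → Spectrum Q) (S : Spectrum P) :
    relUp (mapRel f) S.1 ⊆ (f S).1 := by
  rintro q ⟨p, hp, hqp⟩
  exact hqp S (Spectrum.mem_compatPoints hω hp)

theorem subset_relUp_mapRel (hω : IsOmega P) (hP : IsRegular P) {f : Spectrum P → Spectrum Q}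
    (hf : Continuous f) (S : Spectrum P) : (f S).1 ⊆ relUp (mapRel f) S.1 := by
  intro q hq
  obtain ⟨_, ⟨p, rfl⟩, hp, hpq⟩ :=
    (isTopologicalBasis_spectrum hω).exists_subset_of_mem_open hq ((isOpen_basic q).preimage hf)
  obtain ⟨s, hs, hps⟩ := round_of_minimal hω hP S.2 hp
  exact ⟨s, hs, fun T hT => hpq (starAbove_iff_forall_compatPoints.1 hps T hT)⟩

theorem isRefiner_mapRel (hω : IsOmega P) (hP : IsRegular P) {f : Spectrum P → Spectrum Q}
    (hf : Continuous f) : IsRefiner (mapRel f) := by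
  intro C hC
  refine ⟨{d | ∃ c ∈ C, mapRel f c d}, isCap_iff_forall_spectrum.2 fun S => ?_, fun _ hd => hd⟩
  obtain ⟨c, hcS, hcC⟩ := (f S).2.1 C hC
  obtain ⟨s, hs, hcs⟩ := subset_relUp_mapRel hω hP hf S hcS
  exact ⟨s, hs, c, hcC, hcs⟩

theorem wedgePreserving_mapRel (hω : IsOmega P) (hprime : IsPrime P) (hω' : IsOmega Q)
    (f : Spectrum P → Spectrum Q) : WedgePreserving (mapRel f) := by
  rintro q p p' q' hqp ⟨w, hwp, hwp'⟩ hqp'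
  obtain ⟨S, hS, hw⟩ := hprime w
  refine (f ⟨S, hS⟩).linked_self hω' q ?_ q' ?_
  · exact relUp_mapRel_subset hω f ⟨S, hS⟩ ⟨p, mem_of_le_of_minimal hS hw hwp, hqp⟩
  · exact relUp_mapRel_subset hω f ⟨S, hS⟩ ⟨p', mem_of_le_of_minimal hS hw hwp', hqp'⟩

theorem coe_phi_mapRel (hω : IsOmega P) (hω' : IsOmega Q) (hQ : IsRegular Q)
    {f : Spectrum P → Spectrum Q} (hr : IsRefiner (mapRel f)) (hw : WedgePreserving (mapRel f)) :
    ⇑(phi hω hQ (mapRel f) hr hw) = f :=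
  funext fun S => (phi_eq_iff_linked hω hω' hQ hr hw).2 fun q hq =>
    (f S).linked_self hω' q (relUp_mapRel_subset hω f S hq)

theorem starComp_starAbove_eq_mapRel_phi (hω : IsOmega P) (hQ : IsRegular Q) {r : Q → P → Prop}
    (hr : IsRefiner r) (hw : WedgePreserving r) :
    starComp StarAbove r = mapRel (phi hω hQ r hr hw) := by
  have hmem (S : Spectrum P) (q : Q) :
      q ∈ relUp (Relation.Comp StarAbove r) S.1 ↔ q ∈ (phi hω hQ r hr hw S).1 :=
    ⟨fun ⟨p, hp, q', hqq', hq'p⟩ => ⟨q', ⟨p, hp, hq'p⟩, hqq'⟩,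
      fun ⟨q', ⟨p, hp, hq'p⟩, hqq'⟩ => ⟨p, hp, q', hqq', hq'p⟩⟩
  funext q p
  simp only [starComp, star_iff_forall_compatPoints, hmem, mapRel]

theorem mapRel_eq_starComp_starAbove (hω : IsOmega P) (hω' : IsOmega Q) (hQ : IsRegular Q)
    {f : Spectrum P → Spectrum Q} (hr : IsRefiner (mapRel f)) (hw : WedgePreserving (mapRel f)) :
    mapRel f = starComp StarAbove (mapRel f) := by
  rw [starComp_starAbove_eq_mapRel_phi hω hQ hr hw, coe_phi_mapRel hω hω' hQ]

end ContinuousMaps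

/-! ### Sequences of covers of compact metrisable spaces -/

section Covers

variable {X : Type*}

/-- A finite cover by nonempty open sets. -/
structure IsFiniteOpenCover [TopologicalSpace X] (𝒞 : Set (Set X)) : Prop where
  finite : 𝒞.Finite
  isOpen : ∀ U ∈ 𝒞, IsOpen U
  nonempty : ∀ U ∈ 𝒞, U.Nonempty
  sUnion_eq : ⋃₀ 𝒞 = Set.univ

/-- Refinement of covers up to closures. -/
def ClosureRefines [TopologicalSpace X] (𝒟 𝒞 : Set (Set X)) : Prop :=
  ∀ V ∈ 𝒟, ∃ U ∈ 𝒞, closure V ⊆ U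

/-- A sequence of finite open covers from which a poset with the given space as its spectrum can be
built. The field `exists_closure_subset` keeps the elements of `cover n` from being minimal in
that poset, so that each of its levels is a band. -/
structure CoverSeq (X : Type*) [TopologicalSpace X] where
  cover : ℕ → Set (Set X)
  isFiniteOpenCover : ∀ n, IsFiniteOpenCover (cover n)
  closureRefines_succ : ∀ n, ClosureRefines (cover (n + 1)) (cover n)
  exists_closure_subset : ∀ n, ∀ U ∈ cover n, ∃ V ∈ cover (n + 1), closure V ⊆ U
  eventually_closureRefines : ∀ 𝒰 : Set (Set X), (∀ U ∈ 𝒰, IsOpen U) → ⋃₀ 𝒰 = Set.univ →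
    ∀ᶠ n in atTop, ClosureRefines (cover n) 𝒰

section Metric

variable [PseudoMetricSpace X]

/-- The balls of radius `ρ` centred at the points of `t`. -/
def ballCover (ρ : ℝ) (t : Set X) : Set (Set X) :=
  (Metric.ball · ρ) '' t

theorem exists_isFiniteOpenCover_ballCover [CompactSpace X] {ρ : ℝ} (hρ : 0 < ρ) :
    ∃ t : Set X, IsFiniteOpenCover (ballCover ρ t) := by
  obtain ⟨t, ht, hcov⟩ :=
    Metric.totallyBounded_iff.1 (isCompact_univ (X := X)).totallyBounded ρ hρ
  exact ⟨t,
    { finite := ht.image _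
      isOpen := Set.forall_mem_image.2 fun _ _ => Metric.isOpen_ball
      nonempty := Set.forall_mem_image.2 fun _ _ => Metric.nonempty_ball.2 hρ
      sUnion_eq := by rwa [ballCover, Set.sUnion_image, ← Set.univ_subset_iff] }⟩

theorem eventually_closureRefines_ballCover [CompactSpace X] {𝒰 : Set (Set X)}
    (ho : ∀ U ∈ 𝒰, IsOpen U) (hcov : ⋃₀ 𝒰 = Set.univ) :
    ∀ᶠ ρ in 𝓝[>] (0 : ℝ), ∀ t : Set X, ClosureRefines (ballCover ρ t) 𝒰 := by
  obtain ⟨ε, hε, hball⟩ :=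
    lebesgue_number_lemma_of_metric_sUnion isCompact_univ ho hcov.ge
  filter_upwards [Ioo_mem_nhdsGT hε] with ρ hρ t
  refine Set.forall_mem_image.2 fun y _ => ?_
  obtain ⟨U, hU, hyU⟩ := hball y (Set.mem_univ y)
  exact ⟨U, hU, Metric.closure_ball_subset_closedBall.trans
    ((Metric.closedBall_subset_ball hρ.2).trans hyU)⟩

theorem eventually_exists_mem_ballCover_closure_subset {U : Set X} (ho : IsOpen U)
    (hne : U.Nonempty) :
    ∀ᶠ ρ in 𝓝[>] (0 : ℝ), ∀ t : Set X, ⋃₀ ballCover ρ t = Set.univ →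
      ∃ V ∈ ballCover ρ t, closure V ⊆ U := by
  obtain ⟨x, hx⟩ := hne
  obtain ⟨ε, hε, hxU⟩ := Metric.isOpen_iff.1 ho x hx
  filter_upwards [Ioo_mem_nhdsGT (half_pos hε)] with ρ hρ t ht
  obtain ⟨_, ⟨y, hy, rfl⟩, hxy⟩ := Set.sUnion_eq_univ_iff.1 ht x
  have hdist : ρ + dist y x < ε := by linarith [hρ.2, Metric.mem_ball'.1 hxy]
  exact ⟨_, ⟨y, hy, rfl⟩, Metric.closure_ball_subset_closedBall.trans
    ((Metric.closedBall_subset_ball' hdist).trans hxU)⟩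

theorem IsFiniteOpenCover.exists_ballCover [CompactSpace X] {𝒞 : Set (Set X)}
    (h𝒞 : IsFiniteOpenCover 𝒞) {δ : ℝ} (hδ : 0 < δ) :
    ∃ ρ ∈ Set.Ioo 0 δ, ∃ t : Set X, IsFiniteOpenCover (ballCover ρ t) ∧
      ClosureRefines (ballCover ρ t) 𝒞 ∧ ∀ U ∈ 𝒞, ∃ V ∈ ballCover ρ t, closure V ⊆ U := by
  have hrefines := eventually_closureRefines_ballCover h𝒞.isOpen h𝒞.sUnion_eq
  have hinner := (eventually_all_finite h𝒞.finite).2 fun U hU =>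
    eventually_exists_mem_ballCover_closure_subset (h𝒞.isOpen U hU) (h𝒞.nonempty U hU)
  have hsmall : ∀ᶠ ρ in 𝓝[>] (0 : ℝ), ρ ∈ Set.Ioo 0 δ := Ioo_mem_nhdsGT hδ
  obtain ⟨ρ, hρ, hρ_refines, hρ_inner⟩ := (hsmall.and (hrefines.and hinner)).exists
  obtain ⟨t, ht⟩ := exists_isFiniteOpenCover_ballCover (X := X) hρ.1
  exact ⟨ρ, hρ, t, ht, hρ_refines t, fun U hU => hρ_inner U hU t ht.sUnion_eq⟩

variable (X) in
theorem exists_ballCover_seq [CompactSpace X] :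
    ∃ (ρ : ℕ → ℝ) (t : ℕ → Set X), Tendsto ρ atTop (𝓝[>] 0) ∧ ∀ n,
      IsFiniteOpenCover (ballCover (ρ n) (t n)) ∧
      ClosureRefines (ballCover (ρ (n + 1)) (t (n + 1))) (ballCover (ρ n) (t n)) ∧
      ∀ U ∈ ballCover (ρ n) (t n), ∃ V ∈ ballCover (ρ (n + 1)) (t (n + 1)), closure V ⊆ U := by
  let State := {b : ℝ × Set X // 0 < b.1 ∧ IsFiniteOpenCover (ballCover b.1 b.2)}
  have hstep (n : ℕ) (b : State) : ∃ b' : State, b'.1.1 < 1 / ((n : ℝ) + 1) ∧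
      ClosureRefines (ballCover b'.1.1 b'.1.2) (ballCover b.1.1 b.1.2) ∧
      ∀ U ∈ ballCover b.1.1 b.1.2, ∃ V ∈ ballCover b'.1.1 b'.1.2, closure V ⊆ U :=
    let ⟨ρ, hρ, t, ht, h⟩ := b.2.2.exists_ballCover Nat.one_div_pos_of_nat
    ⟨⟨(ρ, t), hρ.1, ht⟩, hρ.2, h⟩
  choose next hlt hrefines hinner using hstep
  obtain ⟨t₀, ht₀⟩ := exists_isFiniteOpenCover_ballCover (X := X) one_pos
  let seq : ℕ → State := Nat.rec ⟨(1, t₀), one_pos, ht₀⟩ next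
  have htendsto : Tendsto (fun n => (seq n).1.1) atTop (𝓝 0) :=
    (tendsto_add_atTop_iff_nat 1).1 <| squeeze_zero (fun n => (seq (n + 1)).2.1.le)
      (fun n => (hlt n (seq n)).le) tendsto_one_div_add_atTop_nhds_zero_nat
  exact ⟨fun n => (seq n).1.1, fun n => (seq n).1.2,
    tendsto_nhdsWithin_iff.2 ⟨htendsto, Eventually.of_forall fun n => (seq n).2.1⟩,
    fun n => ⟨(seq n).2.2, hrefines n (seq n), hinner n (seq n)⟩⟩

end Metric

theorem nonempty_coverSeq (X : Type*) [TopologicalSpace X] [CompactSpace X]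
    [PseudoMetrizableSpace X] : Nonempty (CoverSeq X) := by
  let := pseudoMetrizableSpacePseudoMetric X
  obtain ⟨ρ, t, hρ, h⟩ := exists_ballCover_seq X
  exact ⟨{
    cover := fun n => ballCover (ρ n) (t n)
    isFiniteOpenCover := fun n => (h n).1
    closureRefines_succ := fun n => (h n).2.1
    exists_closure_subset := fun n => (h n).2.2
    eventually_closureRefines := fun 𝒰 ho hcov =>
      (hρ.eventually (eventually_closureRefines_ballCover ho hcov)).mono fun n hn => hn (t n) }⟩

end Covers

/-! ### The poset of a sequence of covers -/

namespace CoverSeq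

variable {X : Type*} [TopologicalSpace X] {𝒞 : CoverSeq X}

/-- The poset of pairs of a level `n` and an element of the `n`-th cover. The level is part of the
data because the same set may occur in several covers. -/
@[ext]
structure Poset (𝒞 : CoverSeq X) where
  level : ℕ
  toSet : Set X
  mem_cover : toSet ∈ 𝒞.cover level

namespace Poset

instance : PartialOrder 𝒞.Poset where
  le p q := p = q ∨ (q.level < p.level ∧ closure p.toSet ⊆ q.toSet)
  le_refl _ := Or.inl rfl
  le_trans := by
    rintro p q r (rfl | ⟨hpq, hpq'⟩) (rfl | ⟨hqr, hqr'⟩)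
    · exact Or.inl rfl
    · exact Or.inr ⟨hqr, hqr'⟩
    · exact Or.inr ⟨hpq, hpq'⟩
    · exact Or.inr ⟨hqr.trans hpq, hpq'.trans (subset_closure.trans hqr')⟩
  le_antisymm := by
    rintro p q (rfl | ⟨hpq, _⟩) (h | ⟨hqp, _⟩)
    · rfl
    · rfl
    · exact h.symm
    · exact absurd hpq hqp.asymm

theorem isOpen (p : 𝒞.Poset) : IsOpen p.toSet :=
  (𝒞.isFiniteOpenCover p.level).isOpen _ p.mem_cover

theorem nonempty (p : 𝒞.Poset) : p.toSet.Nonempty :=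
  (𝒞.isFiniteOpenCover p.level).nonempty _ p.mem_cover

theorem toSet_mono {p q : 𝒞.Poset} : p ≤ q → p.toSet ⊆ q.toSet
  | Or.inl h => h ▸ subset_rfl
  | Or.inr h => subset_closure.trans h.2

theorem level_anti {p q : 𝒞.Poset} : p ≤ q → q.level ≤ p.level
  | Or.inl h => h ▸ le_rfl
  | Or.inr h => h.1.le

theorem exists_level_mem (n : ℕ) (x : X) : ∃ p : 𝒞.Poset, p.level = n ∧ x ∈ p.toSet :=
  let ⟨U, hU, hx⟩ := Set.sUnion_eq_univ_iff.1 (𝒞.isFiniteOpenCover n).sUnion_eq x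
  ⟨⟨n, U, hU⟩, rfl, hx⟩

theorem exists_ge_level (p : 𝒞.Poset) {n : ℕ} (h : n ≤ p.level) : ∃ q ≥ p, q.level = n := by
  induction h using Nat.decreasingInduction with
  | self => exact ⟨p, le_rfl, rfl⟩
  | of_succ n _ ih =>
    obtain ⟨q, hpq, hq⟩ := ih
    obtain ⟨U, hU, hqU⟩ := 𝒞.closureRefines_succ n q.toSet (hq ▸ q.mem_cover)
    have hqU' : q ≤ ⟨n, U, hU⟩ := Or.inr ⟨hq ▸ n.lt_succ_self, hqU⟩
    exact ⟨⟨n, U, hU⟩, hpq.trans hqU', rfl⟩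

theorem exists_le_level (p : 𝒞.Poset) {n : ℕ} (h : p.level ≤ n) : ∃ q ≤ p, q.level = n := by
  induction n, h using Nat.le_induction with
  | base => exact ⟨p, le_rfl, rfl⟩
  | succ n _ ih =>
    obtain ⟨q, hqp, rfl⟩ := ih
    obtain ⟨V, hV, hVq⟩ := 𝒞.exists_closure_subset _ _ q.mem_cover
    have hVq' : ⟨q.level + 1, V, hV⟩ ≤ q := Or.inr ⟨q.level.lt_succ_self, hVq⟩
    exact ⟨⟨q.level + 1, V, hV⟩, hVq'.trans hqp, rfl⟩

theorem finite_level (n : ℕ) : {p : 𝒞.Poset | p.level = n}.Finite := by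
  refine Set.Finite.of_finite_image (f := toSet) ((𝒞.isFiniteOpenCover n).finite.subset ?_) ?_
  · rintro _ ⟨p, rfl, rfl⟩
    exact p.mem_cover
  · exact fun p hp q hq h => Poset.ext (hp.trans hq.symm) h

theorem finite_level_le (n : ℕ) : {p : 𝒞.Poset | p.level ≤ n}.Finite :=
  (Set.finite_Iic n).preimage' fun k _ => finite_level k

theorem finite_Ici (p : 𝒞.Poset) : (Set.Ici p).Finite :=
  (finite_level_le p.level).subset fun _ => level_anti

theorem level_lt_ncard_Ici (p : 𝒞.Poset) : p.level < (Set.Ici p).ncard :=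
  calc
    p.level < (Set.Iic p.level).ncard := by
      rw [Set.ncard_eq_toFinset_card', Set.toFinset_Iic, Nat.card_Iic]
      exact p.level.lt_succ_self
    _ ≤ (level '' Set.Ici p).ncard :=
      Set.ncard_le_ncard (fun _ => p.exists_ge_level) (p.finite_Ici.image _)
    _ ≤ (Set.Ici p).ncard := Set.ncard_image_le p.finite_Ici

theorem isOmega : IsOmega 𝒞.Poset :=
  ⟨finite_Ici, fun n => (finite_level_le n).subset fun p (hp : (Set.Ici p).ncard = n) =>
    hp ▸ p.level_lt_ncard_Ici.le⟩

theorem isCap_level (n : ℕ) : IsCap {p : 𝒞.Poset | p.level = n} := by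
  refine ⟨_, ⟨finite_level n, fun p => ?_⟩, fun b hb => ⟨b, hb, le_rfl⟩⟩
  rcases le_total n p.level with h | h
  · obtain ⟨q, hpq, hq⟩ := p.exists_ge_level h
    exact ⟨q, hq, Or.inl hpq⟩
  · obtain ⟨q, hqp, hq⟩ := p.exists_le_level h
    exact ⟨q, hq, Or.inr hqp⟩

theorem isCap_iff_exists_level {C : Set 𝒞.Poset} :
    IsCap C ↔ ∃ n, ∀ p : 𝒞.Poset, p.level = n → ∃ c ∈ C, p ≤ c := by
  refine ⟨?_, fun ⟨n, h⟩ => (isCap_level n).of_refines h⟩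
  rintro ⟨B, ⟨hfin, hB⟩, hBC⟩
  obtain ⟨N, hN⟩ := (hfin.image level).bddAbove
  refine ⟨N + 1, fun p hp => ?_⟩
  obtain ⟨b, hb, hpb | hbp⟩ := hB p
  · obtain ⟨c, hc, hbc⟩ := hBC b hb
    exact ⟨c, hc, hpb.trans hbc⟩
  · have hbN : b.level ≤ N := hN ⟨b, hb, rfl⟩
    have hpb : p.level ≤ b.level := level_anti hbp
    omega

theorem eventually_forall_le (q : 𝒞.Poset) {F : Set X} (hF : IsClosed F) (hFq : F ⊆ q.toSet) :
    ∀ᶠ n in atTop, ∀ p : 𝒞.Poset, p.level = n → (p.toSet ∩ F).Nonempty → p ≤ q := by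
  have hrefines := 𝒞.eventually_closureRefines {q.toSet, Fᶜ}
    (by simp only [Set.forall_mem_insert, Set.mem_singleton_iff, forall_eq, q.isOpen,
      hF.isOpen_compl, and_self])
    (by rw [Set.sUnion_pair, ← Set.univ_subset_iff, ← Set.union_compl_self F]
        exact Set.union_subset_union_left _ hFq)
  filter_upwards [hrefines, eventually_gt_atTop q.level] with n hn hqn p hp ⟨x, hxp, hxF⟩
  obtain ⟨_, rfl | rfl, hpU⟩ := hn p.toSet (hp ▸ p.mem_cover)
  · exact Or.inr ⟨hp ▸ hqn, hpU⟩
  · exact absurd hxF (hpU (subset_closure hxp))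

theorem toSet_inter_nonempty {p q : 𝒞.Poset} : Compat p q → (p.toSet ∩ q.toSet).Nonempty :=
  fun ⟨r, hp, hq⟩ => r.nonempty.mono (Set.subset_inter (toSet_mono hp) (toSet_mono hq))

theorem starAbove_of_closure_subset {p q : 𝒞.Poset} (h : closure p.toSet ⊆ q.toSet) :
    StarAbove q p := by
  obtain ⟨n, hn⟩ := (q.eventually_forall_le isClosed_closure h).exists
  exact ⟨_, isCap_level n, fun c hc => hn c hc.1
    ((toSet_inter_nonempty hc.2).mono (Set.inter_subset_inter_right _ subset_closure))⟩

theorem isRegular : IsRegular 𝒞.Poset := by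
  intro C hC
  obtain ⟨n, hn⟩ := isCap_iff_exists_level.1 hC
  refine ⟨_, isCap_level (n + 1), fun d (hd : d.level = n + 1) => ?_⟩
  obtain ⟨U, hU, hdU⟩ := 𝒞.closureRefines_succ n d.toSet (hd ▸ d.mem_cover)
  obtain ⟨c, hc, hUc⟩ := hn ⟨n, U, hU⟩ rfl
  exact ⟨c, hc, starAbove_of_closure_subset (hdU.trans (toSet_mono hUc))⟩

/-- The elements containing a point `x`. In a T₁ space this is the point of the spectrum
corresponding to `x`. -/
def pointSet (x : X) : Set 𝒞.Poset :=
  {p | x ∈ p.toSet}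

theorem isSelector_pointSet (x : X) : IsSelector (pointSet x : Set 𝒞.Poset) := by
  intro C hC
  obtain ⟨n, hn⟩ := isCap_iff_exists_level.1 hC
  obtain ⟨p, hp, hx⟩ := exists_level_mem (𝒞 := 𝒞) n x
  obtain ⟨c, hc, hpc⟩ := hn p hp
  exact ⟨c, toSet_mono hpc hx, hc⟩

section T1Space

variable [T1Space X]

theorem minimal_pointSet (x : X) : Minimal IsSelector (pointSet x : Set 𝒞.Poset) := by
  refine ⟨isSelector_pointSet x, fun T hT hTx p hp => ?_⟩
  obtain ⟨n, hn⟩ :=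
    (p.eventually_forall_le isClosed_singleton (Set.singleton_subset_iff.2 hp)).exists
  have hcap : IsCap ({p} ∪ (pointSet x)ᶜ) := isCap_iff_exists_level.2 ⟨n, fun q hq => by
    by_cases hx : x ∈ q.toSet
    · exact ⟨p, Or.inl rfl, hn q hq ⟨x, hx, rfl⟩⟩
    · exact ⟨q, Or.inr hx, le_rfl⟩⟩
  obtain ⟨t, htT, rfl | ht⟩ := hT _ hcap
  · exact htT
  · exact absurd (hTx htT) ht

theorem isPrime : IsPrime 𝒞.Poset := fun p =>
  let ⟨x, hx⟩ := p.nonempty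
  ⟨pointSet x, minimal_pointSet x, hx⟩

/-- The canonical map from a T₁ space to the spectrum of the poset of a sequence of covers. It is a
homeomorphism if the space is compact. -/
def toSpectrum : C(X, Spectrum 𝒞.Poset) where
  toFun x := ⟨pointSet x, minimal_pointSet x⟩
  continuous_toFun := continuous_generateFrom_iff.2 (Set.forall_mem_range.2 isOpen)

theorem toSpectrum_injective : Function.Injective (toSpectrum : C(X, Spectrum 𝒞.Poset)) := by
  intro x y hxy
  by_contra hne
  have hcov : ⋃₀ {({x}ᶜ : Set X), {y}ᶜ} = Set.univ := by
    rw [Set.sUnion_pair, ← Set.compl_inter, Set.compl_univ_iff, Set.singleton_inter_eq_empty]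
    exact hne
  obtain ⟨n, hn⟩ := (𝒞.eventually_closureRefines {{x}ᶜ, {y}ᶜ}
    (by simp only [Set.forall_mem_insert, Set.mem_singleton_iff, forall_eq, isOpen_compl_singleton,
      and_self]) hcov).exists
  obtain ⟨p, hp, hx⟩ := exists_level_mem (𝒞 := 𝒞) n x
  have hset : (pointSet x : Set 𝒞.Poset) = pointSet y := congrArg Spectrum.carrier hxy
  have hy : p ∈ (pointSet y : Set 𝒞.Poset) := hset ▸ hx
  obtain ⟨_, rfl | rfl, hpU⟩ := hn p.toSet (hp ▸ p.mem_cover)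
  · exact hpU (subset_closure hx) rfl
  · exact hpU (subset_closure hy) rfl

theorem denseRange_toSpectrum : DenseRange (toSpectrum : C(X, Spectrum 𝒞.Poset)) := by
  refine (isTopologicalBasis_spectrum isOmega).dense_iff.2 (Set.forall_mem_range.2 fun p _ => ?_)
  obtain ⟨x, hx⟩ := p.nonempty
  exact ⟨toSpectrum x, hx, x, rfl⟩

theorem toSpectrum_surjective [CompactSpace X] :
    Function.Surjective (toSpectrum : C(X, Spectrum 𝒞.Poset)) := by
  have := t2Space_spectrum (isOmega (𝒞 := 𝒞)) isRegular
  have hclosed := (isCompact_range (toSpectrum (𝒞 := 𝒞)).continuous).isClosed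
  rw [← Set.range_eq_univ, ← hclosed.closure_eq]
  exact denseRange_toSpectrum.closure_range

end T1Space

end Poset

end CoverSeq

/-! ### The functors -/

/-- The functor `S : P ⥤ K`. -/
def spectrumFunctorP : CatP.{u} ⥤ CatK.{u} where
  __ := spectrumP
  map_id X := congrArg (ConcreteCategory.ofHom (X := spectrumObj X) (Y := spectrumObj X))
    (phi_id X.omega X.regular)
  map_comp {X Y Z} f g :=
    congrArg (ConcreteCategory.ofHom (X := spectrumObj X) (Y := spectrumObj Z))
      (phi_comp X.omega Y.omega Y.regular Z.omega Z.regular g.isRefiner g.wedgePreserving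
        f.isRefiner f.wedgePreserving)

/-- The functor `S|_S : S ⥤ K` given by restriction to strong refiners. -/
def spectrumFunctorS : CatS.{u} ⥤ CatK.{u} where
  __ := spectrumS
  map_id X := congrArg (ConcreteCategory.ofHom (X := spectrumObj X.1) (Y := spectrumObj X.1))
    (phi_starAbove X.poset.omega X.poset.regular)
  map_comp {X Y Z} f g :=
    congrArg (ConcreteCategory.ofHom (X := spectrumObj X.1) (Y := spectrumObj Z.1))
      (phi_starComp X.poset.omega X.poset.regular Y.poset.omega Y.poset.regular Z.poset.omega
        Z.poset.regular g.isRefiner g.wedgePreserving f.isRefiner f.wedgePreserving)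

instance : spectrumFunctorS.{u}.Faithful where
  map_injective {X Y} f g hfg := by
    have hphi : phi X.poset.omega Y.poset.regular f.rel f.isRefiner f.wedgePreserving =
        phi X.poset.omega Y.poset.regular g.rel g.isRefiner g.wedgePreserving :=
      congrArg ConcreteCategory.hom hfg
    refine StrongRefiner.ext ?_
    rw [f.strong, g.strong, starComp_starAbove_eq_mapRel_phi X.poset.omega Y.poset.regular
        f.isRefiner f.wedgePreserving, hphi,
      ← starComp_starAbove_eq_mapRel_phi X.poset.omega Y.poset.regular]

instance : spectrumFunctorS.{u}.Full where
  map_surjective {X Y} g := by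
    let f : C(Spectrum X.poset, Spectrum Y.poset) := ConcreteCategory.hom g
    have hr : IsRefiner (mapRel f) :=
      isRefiner_mapRel X.poset.omega X.poset.regular f.continuous
    have hw : WedgePreserving (mapRel f) :=
      wedgePreserving_mapRel X.poset.omega X.poset.prime Y.poset.omega f
    exact ⟨⟨⟨mapRel f, hr, hw⟩,
        mapRel_eq_starComp_starAbove X.poset.omega Y.poset.omega Y.poset.regular hr hw⟩,
      ConcreteCategory.hom_ext _ _ <|
        congrFun (coe_phi_mapRel X.poset.omega Y.poset.omega Y.poset.regular hr hw)⟩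

instance : spectrumFunctorS.{u}.EssSurj where
  mem_essImage K := by
    have : MetrizableSpace K := K.prop
    obtain ⟨𝒞⟩ := nonempty_coverSeq K
    let X : CatS.{u} :=
      ⟨⟨𝒞.Poset, CoverSeq.Poset.isOmega, CoverSeq.Poset.isRegular, CoverSeq.Poset.isPrime⟩⟩
    let f : K ⟶ spectrumFunctorS.obj X :=
      ConcreteCategory.ofHom (X := K) (Y := spectrumObj X.poset)
        (CoverSeq.Poset.toSpectrum : C(K, Spectrum 𝒞.Poset))
    exact ⟨X, ⟨(CompHausLike.isoOfBijective f
      ⟨CoverSeq.Poset.toSpectrum_injective, CoverSeq.Poset.toSpectrum_surjective⟩).symm⟩⟩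

theorem spectrumFunctorS_map_quotientMap {X Y : CatP.{u}} (f : X ⟶ Y) :
    spectrumFunctorS.map (quotientMap.map f) = spectrumFunctorP.map f := by
  refine congrArg (ConcreteCategory.ofHom (X := spectrumObj X) (Y := spectrumObj Y)) ?_
  refine (phi_starComp X.omega X.regular Y.omega Y.regular Y.omega Y.regular
    (isRefiner_starAbove Y.regular) wedgePreserving_starAbove f.isRefiner
    f.wedgePreserving).trans ?_
  rw [phi_starAbove Y.omega Y.regular, ContinuousMap.id_comp]

/-- The functor `Q : P ⥤ S`. Its functoriality is reflected from that of `S` along the faithful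
functor `S|_S`. -/
def quotientFunctor : CatP.{u} ⥤ CatS.{u} where
  __ := quotientMap
  map_id X := spectrumFunctorS.map_injective <| by
    rw [spectrumFunctorS_map_quotientMap, spectrumFunctorP.map_id]
    exact (spectrumFunctorS.map_id _).symm
  map_comp f g := spectrumFunctorS.map_injective <| by
    rw [spectrumFunctorS.map_comp, spectrumFunctorS_map_quotientMap,
      spectrumFunctorS_map_quotientMap, spectrumFunctorS_map_quotientMap]
    exact spectrumFunctorP.map_comp f g

theorem spectrumFunctorP_eq_comp : spectrumFunctorP.{u} = quotientFunctor ⋙ spectrumFunctorS :=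
  Functor.hext (fun _ => rfl) fun _ _ f => heq_of_eq (spectrumFunctorS_map_quotientMap f).symm

end OmegaPoset

theorem mainTheorem1 :
    ∃ (SP : OmegaPoset.CatP.{u} ⥤ OmegaPoset.CatK.{u})
      (SS : OmegaPoset.CatS.{u} ⥤ OmegaPoset.CatK.{u})
      (Q : OmegaPoset.CatP.{u} ⥤ OmegaPoset.CatS.{u}),
      SP.toPrefunctor = OmegaPoset.spectrumP ∧
      SS.toPrefunctor = OmegaPoset.spectrumS ∧
      Q.toPrefunctor = OmegaPoset.quotientMap ∧
      SS.Full ∧ SS.Faithful ∧ SS.EssSurj ∧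
      SP = Q ⋙ SS :=
  ⟨OmegaPoset.spectrumFunctorP, OmegaPoset.spectrumFunctorS, OmegaPoset.quotientFunctor,
    rfl, rfl, rfl, inferInstance, inferInstance, inferInstance,
    OmegaPoset.spectrumFunctorP_eq_comp⟩
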